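/- **Setting.** For $n\in\mathbb N_0$ let $P_n(x)=\frac{1}{2^n n!}\frac{d^n}{dx^n}(x^2-1)^n$, let $P_n^k(x)=(1-x^2)^{k/2}\frac{d^k}{dx^k}P_n(x)$ for $0\le k\le n$ and $P_n^k=(-1)^k\frac{(n+k)!}{(n-k)!}P_n^{-k}$ for $-n\le k<0$, and let $$Y_n^k(\theta,\varphi)=(-1)^k\sqrt{\frac{2n+1}{4\pi}\frac{(n-k)!}{(n+k)!}}\;P_n^k(\cos\theta)\,e^{\mathrm i k\varphi},\qquad |k|\le n,$$ be the spherical harmonics on $\mathbb S^2$ in the coordinates $(\sin\theta\cos\varphi,\sin\theta\sin\varphi,\cos\theta)$. For integers $K\ge 1$, $n\ge0$, $|k|\le n$ put $$\zeta_{n,k}^K=\eta\,\nu\,\sqrt{\frac1{2^p}\binom{p}{\frac{p-k}{2}}}\ \text{ if } |k|\le K-1,\qquad \zeta_{n,k}^K=0\ \text{ if } |k|\ge K,$$ where $\eta=1$ if $K-1$ is even and $\eta=\mathrm i$ if $K-1$ is odd; $\nu=1$ if $K+k$ is odd and $\nu=0$ if $K+k$ is even (in which case $\zeta_{n,k}^K=0$);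 $p=\min(K-1,n-1)$ if $K+n$ is even and $p=\min(K-1,n)$ if $K+n$ is odd. For a function $\kappa:[0,\infty)\to\mathbb R$ with $\emptyset\ne\operatorname{supp}(\kappa)\subset[1/2,2]$ and an integer $N\ge 1$, the directional wavelet is $$\Psi_K^N=\sum_{n=0}^\infty\sum_{k=-n}^n\sqrt{\frac{2n+1}{8\pi^2}}\;\kappa\!\left(\frac nN\right)\zeta_{n,k}^K\,Y_n^k .$$ **Proposition (localization bound for directional wavelets).** Let $K\ge1$ and $q\ge1$ be integers and let $\kappa$ be as above with $\kappa\in C^{3q-1}([0,\infty))$. Then there exists a constant $c=c(\kappa,K,q)>0$ such that for all integers $N\ge1$, all $\theta\in[0,\pi]$ and all $\varphi\in[0,2\pi)$, $$|\Psi_K^N(\theta,\varphi)|\le\frac{cN^2}{(1+N\theta)^q}\sum_{k=0}^{K-1}(N\sin\theta)^k ,$$ and in particular $$|\Psi_K^N(\theta,\varphi)|\le\frac{cN^2}{(1+N\theta)^{q+1-K}} .$$ (The term $k=0$ of the sum equals $1$.) -/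

import Mathlib

namespace DirectionalWavelet

open Polynomial in
/-- The Legendre polynomial `P_n`, by the Rodrigues formula. -/
noncomputable def legendreP (n : ℕ) : ℝ[X] :=
  C (1 / (2 ^ n * (n.factorial : ℝ))) * derivative^[n] ((X ^ 2 - 1) ^ n)

/-- The associated Legendre function of nonnegative order `k`,
`(1 - x ^ 2) ^ (k / 2) * (d / dx) ^ k P_n`, for `x ∈ [-1, 1]`. -/
noncomputable def assocLegendreNat (n k : ℕ) (x : ℝ) : ℝ :=
  Real.sqrt (1 - x ^ 2) ^ k * (Polynomial.derivative^[k] (legendreP n)).eval x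

/-- The associated Legendre function `P_n^k` of degree `n` and order `k ∈ {-n, ..., n}`;
for `k < 0` it is `(-1) ^ k * (n + k)! / (n - k)! * P_n^{-k}`. -/
noncomputable def assocLegendre (n : ℕ) (k : ℤ) (x : ℝ) : ℝ :=
  if 0 ≤ k then assocLegendreNat n k.toNat x
  else (-1 : ℝ) ^ k *
    ((((n : ℤ) + k).toNat.factorial : ℝ) / (((n : ℤ) - k).toNat.factorial : ℝ)) *
    assocLegendreNat n (-k).toNat x

/-- The spherical harmonic `Y_n^k`, `k ∈ {-n, ..., n}`, in the spherical coordinates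
`(sin θ cos φ, sin θ sin φ, cos θ)`. -/
noncomputable def sphericalHarmonic (n : ℕ) (k : ℤ) (θ φ : ℝ) : ℂ :=
  (-1 : ℂ) ^ k *
    (Real.sqrt ((2 * (n : ℝ) + 1) / (4 * Real.pi) *
      ((((n : ℤ) - k).toNat.factorial : ℝ) / (((n : ℤ) + k).toNat.factorial : ℝ))) : ℂ) *
    (assocLegendre n k (Real.cos θ) : ℂ) *
    Complex.exp (Complex.I * (k : ℂ) * (φ : ℂ))

/-- The phase `η`. -/
noncomputable def eta (K : ℕ) : ℂ := if Even (K - 1) then 1 else Complex.I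

/-- The parity factor `ν`. -/
noncomputable def nu (K : ℕ) (k : ℤ) : ℂ := if Odd ((K : ℤ) + k) then 1 else 0

/-- The number `p`. The subtraction `n - 1` truncates only for `n = 0` and `K` even, where the
only order `k = 0` has `ν = 0`. -/
def binomTop (K n : ℕ) : ℕ := if Even (K + n) then min (K - 1) (n - 1) else min (K - 1) n

/-- The directionality component `ζ_{n,k}^K`, for `|k| ≤ n`. Where `ν = 1`, one has `|k| ≤ p`
and `p - k` is even, so the lower entry of the binomial coefficient is the honest
`(p - k) / 2`. -/
noncomputable def directionality (K n : ℕ) (k : ℤ) : ℂ :=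
  if |k| ≤ (K : ℤ) - 1 then
    eta K * nu K k *
      (Real.sqrt (1 / 2 ^ binomTop K n *
        ((binomTop K n).choose (((binomTop K n : ℤ) - k) / 2).toNat : ℝ)) : ℂ)
  else 0

/-- `κ : [0, ∞) → ℝ` is a window function of class `C^r` on `[0, ∞)`, with nonempty support
contained in `[1/2, 2]`. Values of `κ` at negative numbers are irrelevant. -/
structure IsWindow (r : ℕ) (κ : ℝ → ℝ) : Prop where
  contDiffOn : ContDiffOn ℝ r κ (Set.Ici 0)
  support_nonempty : (closure (Function.support κ ∩ Set.Ici 0)).Nonempty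
  support_subset : closure (Function.support κ ∩ Set.Ici 0) ⊆ Set.Icc (1 / 2) 2

/-- The directional wavelet `Ψ_K^N` at the point with spherical coordinates `(θ, φ)`. If `κ` is a
window function and `1 ≤ N`, then only the terms with `N / 2 ≤ n ≤ 2 * N` can be nonzero. -/
noncomputable def wavelet (κ : ℝ → ℝ) (K N : ℕ) (θ φ : ℝ) : ℂ :=
  ∑' n : ℕ, ∑ k ∈ Finset.Icc (-(n : ℤ)) (n : ℤ),
    (Real.sqrt ((2 * (n : ℝ) + 1) / (8 * Real.pi ^ 2)) : ℂ) * (κ ((n : ℝ) / (N : ℝ)) : ℂ) *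
      directionality K n k * sphericalHarmonic n k θ φ

end DirectionalWavelet

/-!
Multiplying a Legendre series `∑ n, (2 * n + 1) * g n * P_n^{(k)}` by `1 - x` acts on the
coefficients `g` as a second-order difference operator, by the three-term recurrence. The
coefficients that occur in the wavelet, `κ (n / N)` times a weight of size `n ^ (-|k|)`, lose one
power of `n` with every difference, uniformly in `N`; hence each factor `1 - cos θ`, which is at
least a multiple of `θ ^ 2`, gains a factor `N ^ (-2)`. Together with `|P_n^{(k)}| ≤ n ^ (2 * k)`
this bounds the part of order `k` by `N ^ 2 * (N * sin θ) ^ |k| / (1 + N * θ) ^ q`, the factor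
`sin θ ^ |k|` coming from the associated Legendre function. Only the orders `|k| < K` occur.
-/

namespace DirectionalWavelet

open Filter Topology Asymptotics Polynomial Set
open scoped fwdDiff

/-! ### Legendre polynomials -/

section Rodrigues

variable {R : Type*} [CommRing R]

theorem iterate_derivative_X_mul_eq (p : R[X]) (n : ℕ) :
    derivative^[n] (X * p) = X * derivative^[n] p + (n : R[X]) * derivative^[n - 1] p := by
  rw [mul_comm, iterate_derivative_mul_X, nsmul_eq_mul, mul_comm]

theorem iterate_derivative_X_sq_sub_one_mul (p : R[X]) (n : ℕ) :
    derivative^[n + 1] ((X ^ 2 - 1) * p) = (X ^ 2 - 1) * derivative^[n + 1] p +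
      2 * ((n : R[X]) + 1) * (X * derivative^[n] p) +
        ((n : R[X]) + 1) * (n : R[X]) * derivative^[n - 1] p := by
  rw [show (X ^ 2 - 1) * p = X * (X * p) - p by ring, iterate_derivative_sub]
  simp only [iterate_derivative_X_mul_eq, Nat.add_sub_cancel]
  push_cast
  ring

theorem derivative_X_sq_sub_one_pow (n : ℕ) :
    derivative ((X ^ 2 - 1 : R[X]) ^ (n + 1)) =
      ((2 * (n + 1) : ℕ) : R[X]) * (X * (X ^ 2 - 1) ^ n) := by
  rw [derivative_pow]
  simp only [derivative_sub, derivative_X_pow, derivative_one, map_natCast]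
  push_cast
  ring

theorem iterate_derivative_X_sq_sub_one_pow_succ (n : ℕ) :
    derivative^[n + 1] ((X ^ 2 - 1 : R[X]) ^ (n + 1)) =
      2 * ((X ^ 2 - 1) * derivative^[n + 1] ((X ^ 2 - 1) ^ n)) +
        2 * ((n : R[X]) + 1) * (X * derivative^[n] ((X ^ 2 - 1) ^ n)) := by
  have by_chain_rule : derivative^[n + 1] ((X ^ 2 - 1 : R[X]) ^ (n + 1)) =
      2 * ((n : R[X]) + 1) * (X * derivative^[n] ((X ^ 2 - 1) ^ n) +
        (n : R[X]) * derivative^[n - 1] ((X ^ 2 - 1) ^ n)) := by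
    rw [Function.iterate_succ_apply, derivative_X_sq_sub_one_pow, iterate_derivative_natCast_mul,
      iterate_derivative_X_mul_eq]
    push_cast
    ring
  have by_product_rule := iterate_derivative_X_sq_sub_one_mul ((X ^ 2 - 1 : R[X]) ^ n) n
  rw [← pow_succ'] at by_product_rule
  linear_combination 2 * by_product_rule - by_chain_rule

theorem iterate_derivative_succ_X_sq_sub_one_pow_succ (n : ℕ) :
    derivative^[n + 2] ((X ^ 2 - 1 : R[X]) ^ (n + 1)) =
      2 * ((n : R[X]) + 1) * (X * derivative^[n + 1] ((X ^ 2 - 1) ^ n) +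
        ((n : R[X]) + 1) * derivative^[n] ((X ^ 2 - 1) ^ n)) := by
  rw [Function.iterate_succ_apply, derivative_X_sq_sub_one_pow, iterate_derivative_natCast_mul,
    iterate_derivative_X_mul_eq, Nat.add_sub_cancel]
  push_cast
  ring

end Rodrigues

section Legendre

theorem two_pow_mul_factorial_mul_legendreP (n : ℕ) :
    ((2 ^ n * n.factorial : ℕ) : ℝ[X]) * legendreP n = derivative^[n] ((X ^ 2 - 1) ^ n) := by
  have hn : (2 : ℝ) ^ n * n.factorial ≠ 0 := by positivity
  rw [legendreP, ← mul_assoc, ← C_eq_natCast, ← C_mul]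
  push_cast
  rw [mul_one_div_cancel hn, C_1, one_mul]

theorem natCast_two_pow_mul_factorial_ne_zero (n : ℕ) : ((2 ^ n * n.factorial : ℕ) : ℝ[X]) ≠ 0 :=
  Nat.cast_ne_zero.2 (by positivity)

theorem legendreP_succ (n : ℕ) :
    ((n : ℝ[X]) + 1) * legendreP (n + 1) =
      (X ^ 2 - 1) * derivative (legendreP n) + ((n : ℝ[X]) + 1) * (X * legendreP n) := by
  have rodrigues := two_pow_mul_factorial_mul_legendreP n
  have rodrigues_deriv := congrArg derivative rodrigues
  have rodrigues_succ := two_pow_mul_factorial_mul_legendreP (n + 1)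
  rw [derivative_natCast_mul, ← Function.iterate_succ_apply' derivative] at rodrigues_deriv
  rw [iterate_derivative_X_sq_sub_one_pow_succ, ← rodrigues_deriv, ← rodrigues,
    pow_succ, Nat.factorial_succ] at rodrigues_succ
  refine mul_left_cancel₀ (mul_ne_zero two_ne_zero (natCast_two_pow_mul_factorial_ne_zero n)) ?_
  push_cast at rodrigues_succ ⊢
  linear_combination rodrigues_succ

theorem derivative_legendreP_succ (n : ℕ) :
    derivative (legendreP (n + 1)) =
      X * derivative (legendreP n) + ((n : ℝ[X]) + 1) * legendreP n := by
  have rodrigues := two_pow_mul_factorial_mul_legendreP n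
  have rodrigues_deriv := congrArg derivative rodrigues
  have rodrigues_succ_deriv := congrArg derivative (two_pow_mul_factorial_mul_legendreP (n + 1))
  rw [derivative_natCast_mul, ← Function.iterate_succ_apply' derivative] at rodrigues_deriv
  rw [derivative_natCast_mul, ← Function.iterate_succ_apply' derivative,
    iterate_derivative_succ_X_sq_sub_one_pow_succ, ← rodrigues_deriv, ← rodrigues]
    at rodrigues_succ_deriv
  refine mul_left_cancel₀ (natCast_two_pow_mul_factorial_ne_zero (n + 1)) ?_
  rw [rodrigues_succ_deriv, pow_succ, Nat.factorial_succ]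
  push_cast
  ring

theorem legendreP_differential_equation (n : ℕ) :
    (1 - X ^ 2) * derivative (derivative (legendreP n)) =
      2 * (X * derivative (legendreP n)) - (n : ℝ[X]) * ((n : ℝ[X]) + 1) * legendreP n := by
  have h := congrArg derivative (legendreP_succ n)
  simp only [derivative_mul, derivative_add, derivative_sub, derivative_natCast, derivative_X,
    derivative_X_pow, derivative_one, map_natCast] at h
  push_cast at h
  linear_combination h - ((n : ℝ[X]) + 1) * derivative_legendreP_succ n

theorem X_sq_sub_one_mul_derivative_legendreP_succ (n : ℕ) :
    (X ^ 2 - 1) * derivative (legendreP (n + 1)) =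
      ((n : ℝ[X]) + 1) * (X * legendreP (n + 1) - legendreP n) := by
  linear_combination (X ^ 2 - 1) * derivative_legendreP_succ n - X * legendreP_succ n

theorem legendreP_three_term (n : ℕ) :
    ((n : ℝ[X]) + 2) * legendreP (n + 2) =
      (2 * (n : ℝ[X]) + 3) * (X * legendreP (n + 1)) - ((n : ℝ[X]) + 1) * legendreP n := by
  have h := legendreP_succ (n + 1)
  push_cast at h
  linear_combination h + X_sq_sub_one_mul_derivative_legendreP_succ n

theorem derivative_legendreP_add_two_sub (n : ℕ) :
    derivative (legendreP (n + 2)) - derivative (legendreP n) =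
      (2 * (n : ℝ[X]) + 3) * legendreP (n + 1) := by
  have three_term_deriv := congrArg derivative (legendreP_three_term n)
  have deriv_add_two := derivative_legendreP_succ (n + 1)
  simp only [derivative_mul, derivative_add, derivative_sub, derivative_natCast, derivative_X,
    derivative_ofNat, derivative_one] at three_term_deriv
  push_cast at deriv_add_two
  refine mul_left_cancel₀ (n.cast_add_one_ne_zero (R := ℝ[X])) ?_
  linear_combination (2 * (n : ℝ[X]) + 3) * deriv_add_two - three_term_deriv

theorem iterate_derivative_legendreP_add_two_sub (n k : ℕ) :
    derivative^[k + 1] (legendreP (n + 2)) - derivative^[k + 1] (legendreP n) =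
      (2 * (n : ℝ[X]) + 3) * derivative^[k] (legendreP (n + 1)) := by
  have h := congrArg derivative^[k] (derivative_legendreP_add_two_sub n)
  rw [iterate_derivative_sub, ← Function.iterate_succ_apply, ← Function.iterate_succ_apply] at h
  rw [h, show (2 * (n : ℝ[X]) + 3) = ((2 * n + 3 : ℕ) : ℝ[X]) by push_cast; rfl,
    iterate_derivative_natCast_mul]

theorem iterate_derivative_legendreP_three_term (n k : ℕ) :
    ((n : ℝ[X]) + 2 - (k : ℝ[X])) * derivative^[k] (legendreP (n + 2)) =
      (2 * (n : ℝ[X]) + 3) * (X * derivative^[k] (legendreP (n + 1))) -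
        ((n : ℝ[X]) + 1 + (k : ℝ[X])) * derivative^[k] (legendreP n) := by
  have three_term : ((n + 2 : ℕ) : ℝ[X]) * legendreP (n + 2) =
      ((2 * n + 3 : ℕ) : ℝ[X]) * (X * legendreP (n + 1)) - ((n + 1 : ℕ) : ℝ[X]) * legendreP n := by
    push_cast
    exact legendreP_three_term n
  have h := congrArg derivative^[k] three_term
  simp only [iterate_derivative_sub, iterate_derivative_natCast_mul,
    iterate_derivative_X_mul_eq] at h
  push_cast at h
  cases k with
  | zero => simpa using h
  | succ k =>
    rw [Nat.add_sub_cancel] at h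
    push_cast at h ⊢
    linear_combination h - ((k : ℝ[X]) + 1) * iterate_derivative_legendreP_add_two_sub n k

theorem legendreP_zero : legendreP 0 = 1 := by
  simp [legendreP]

theorem legendreP_one : legendreP 1 = X := by
  simpa [legendreP_zero] using legendreP_succ 0

theorem eval_one_legendreP (n : ℕ) : (legendreP n).eval 1 = 1 := by
  induction n with
  | zero => simp [legendreP_zero]
  | succ n ih =>
    have h := congrArg (eval 1) (legendreP_succ n)
    simp only [eval_mul, eval_add, eval_sub, eval_pow, eval_X, eval_one, eval_natCast, ih] at h
    exact mul_left_cancel₀ (n.cast_add_one_ne_zero (R := ℝ)) (by linear_combination h)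

theorem eval_neg_one_legendreP (n : ℕ) : (legendreP n).eval (-1) = (-1) ^ n := by
  induction n with
  | zero => simp [legendreP_zero]
  | succ n ih =>
    have h := congrArg (eval (-1)) (legendreP_succ n)
    simp only [eval_mul, eval_add, eval_sub, eval_pow, eval_X, eval_one, eval_natCast, ih] at h
    exact mul_left_cancel₀ (n.cast_add_one_ne_zero (R := ℝ)) (by linear_combination h)

/-- Sonin's function `n (n + 1) P_n ^ 2 + (1 - x ^ 2) P_n' ^ 2`. It dominates `n (n + 1) P_n ^ 2` on
`[-1, 1]`, with equality at the endpoints. -/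
noncomputable def legendreSonin (n : ℕ) : ℝ[X] :=
  (n : ℝ[X]) * ((n : ℝ[X]) + 1) * legendreP n ^ 2 + (1 - X ^ 2) * derivative (legendreP n) ^ 2

theorem derivative_legendreSonin (n : ℕ) :
    derivative (legendreSonin n) = 2 * X * derivative (legendreP n) ^ 2 := by
  simp only [legendreSonin, derivative_add, derivative_mul, derivative_sub, derivative_one,
    derivative_pow, derivative_natCast, derivative_X, map_natCast]
  push_cast
  linear_combination (2 * derivative (legendreP n)) * legendreP_differential_equation n

theorem eval_legendreSonin_le (n : ℕ) {x : ℝ} (hx : x ∈ Icc (-1 : ℝ) 1) :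
    (legendreSonin n).eval x ≤ n * (n + 1) := by
  have deriv_eq (y : ℝ) : deriv (fun y ↦ (legendreSonin n).eval y) y =
      2 * y * (derivative (legendreP n)).eval y ^ 2 := by
    simp [Polynomial.deriv, derivative_legendreSonin]
  rcases le_total 0 x with h0 | h0
  · have hmono : MonotoneOn (fun y ↦ (legendreSonin n).eval y) (Icc 0 1) := by
      refine monotoneOn_of_deriv_nonneg (convex_Icc 0 1) (Polynomial.continuousOn _)
        (Polynomial.differentiableOn _) fun y hy ↦ ?_
      rw [interior_Icc] at hy
      have := hy.1.le
      rw [deriv_eq]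
      positivity
    simpa [legendreSonin, eval_one_legendreP] using
      hmono ⟨h0, hx.2⟩ (right_mem_Icc.2 zero_le_one) hx.2
  · have hanti : AntitoneOn (fun y ↦ (legendreSonin n).eval y) (Icc (-1) 0) := by
      refine antitoneOn_of_deriv_nonpos (convex_Icc (-1) 0) (Polynomial.continuousOn _)
        (Polynomial.differentiableOn _) fun y hy ↦ ?_
      rw [interior_Icc] at hy
      rw [deriv_eq]
      exact mul_nonpos_of_nonpos_of_nonneg (by linarith [hy.2]) (sq_nonneg _)
    simpa [legendreSonin, eval_neg_one_legendreP, ← pow_mul, mul_comm n 2] using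
      hanti (left_mem_Icc.2 (by norm_num)) ⟨hx.1, h0⟩ hx.1

theorem abs_eval_legendreP_le_one (n : ℕ) {x : ℝ} (hx : x ∈ Icc (-1 : ℝ) 1) :
    |(legendreP n).eval x| ≤ 1 := by
  rcases n.eq_zero_or_pos with rfl | hn
  · simp [legendreP_zero]
  have h_sonin := eval_legendreSonin_le n hx
  simp only [legendreSonin, eval_add, eval_mul, eval_sub, eval_pow, eval_X, eval_one,
    eval_natCast] at h_sonin
  have h_nonneg : 0 ≤ (1 - x ^ 2) * (derivative (legendreP n)).eval x ^ 2 :=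
    mul_nonneg (by nlinarith [hx.1, hx.2]) (sq_nonneg _)
  have hn' : (0 : ℝ) < n * (n + 1) := by positivity
  rw [← sq_le_one_iff_abs_le_one]
  exact le_of_mul_le_mul_left (by linarith) hn'

theorem abs_eval_iterate_derivative_legendreP_le (k n : ℕ) {x : ℝ} (hx : x ∈ Icc (-1 : ℝ) 1) :
    |(derivative^[k] (legendreP n)).eval x| ≤ (n : ℝ) ^ (2 * k) := by
  induction k generalizing n with
  | zero => simpa using abs_eval_legendreP_le_one n hx
  | succ k ih =>
    induction n using Nat.twoStepInduction with
    | zero => simp [legendreP_zero]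
    | one =>
      rw [Function.iterate_succ_apply, legendreP_one, derivative_X]
      cases k <;> simp [Function.iterate_succ_apply]
    | more n ihn _ =>
      have h := congrArg (eval x) (iterate_derivative_legendreP_add_two_sub n k)
      simp only [eval_sub, eval_mul, eval_add, eval_natCast, eval_ofNat] at h
      calc |(derivative^[k + 1] (legendreP (n + 2))).eval x|
          = |(derivative^[k + 1] (legendreP n)).eval x +
              (2 * (n : ℝ) + 3) * (derivative^[k] (legendreP (n + 1))).eval x| := by
            congr 1; linarith
        _ ≤ |(derivative^[k + 1] (legendreP n)).eval x| +
              (2 * (n : ℝ) + 3) * |(derivative^[k] (legendreP (n + 1))).eval x| := by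
            refine (abs_add_le _ _).trans_eq ?_
            rw [abs_mul, abs_of_nonneg (show (0 : ℝ) ≤ 2 * n + 3 by positivity)]
        _ ≤ (n : ℝ) ^ (2 * (k + 1)) + (2 * n + 3) * ((n + 1 : ℕ) : ℝ) ^ (2 * k) := by
            gcongr
            exact ih (n + 1)
        _ = (n : ℝ) ^ 2 * n ^ (2 * k) + (2 * n + 3) * ((n + 1 : ℕ) : ℝ) ^ (2 * k) := by ring
        _ ≤ (n : ℝ) ^ 2 * ((n + 2 : ℕ) : ℝ) ^ (2 * k) +
              (2 * n + 3) * ((n + 2 : ℕ) : ℝ) ^ (2 * k) := by gcongr <;> simp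
        _ ≤ ((n + 2 : ℕ) : ℝ) ^ 2 * ((n + 2 : ℕ) : ℝ) ^ (2 * k) := by
            rw [← add_mul]
            gcongr
            push_cast
            nlinarith [n.cast_nonneg (α := ℝ)]
        _ = ((n + 2 : ℕ) : ℝ) ^ (2 * (k + 1)) := by ring

end Legendre

/-! ### Symbols in the degree -/

section Symbol

variable {ι : Type*}

theorem isTheta_natCast_add (a : ℝ) :
    (fun x : ι × ℕ ↦ (x.2 : ℝ) + a) =Θ[⊤ ×ˢ atTop] fun x ↦ (x.2 : ℝ) := by
  have const_isLittleO : (fun _ : ℕ ↦ a) =o[atTop] fun n : ℕ ↦ (n : ℝ) :=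
    isLittleO_const_left.2 (.inr (tendsto_norm_atTop_atTop.comp tendsto_natCast_atTop_atTop))
  have h := (IsEquivalent.refl.add_isLittleO const_isLittleO).isTheta
  exact ⟨h.1.comp_tendsto tendsto_snd, h.2.comp_tendsto tendsto_snd⟩

theorem eventually_natCast_snd_pos : ∀ᶠ x : ι × ℕ in ⊤ ×ˢ atTop, (0 : ℝ) < x.2 :=
  ((eventually_gt_atTop 0).mono fun _ hn ↦ Nat.cast_pos.2 hn).prod_inr _

theorem zpow_mul_zpow_eventuallyEq (μ ν : ℤ) :
    (fun x : ι × ℕ ↦ (x.2 : ℝ) ^ μ * (x.2 : ℝ) ^ ν) =ᶠ[⊤ ×ˢ atTop]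
      fun x ↦ (x.2 : ℝ) ^ (μ + ν) :=
  eventually_natCast_snd_pos.mono fun _ hx ↦ (zpow_add₀ hx.ne' μ ν).symm

theorem map_succ_top_prod_atTop :
    map (Prod.map id (· + 1)) ((⊤ : Filter ι) ×ˢ (atTop : Filter ℕ)) = ⊤ ×ˢ atTop := by
  rw [← prod_map_map_eq', map_id, map_add_atTop_eq_nat]

theorem eventually_comp_succ {p : ι × ℕ → Prop} (h : ∀ᶠ x in ⊤ ×ˢ atTop, p x) :
    ∀ᶠ x : ι × ℕ in ⊤ ×ˢ atTop, p (x.1, x.2 + 1) := by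
  rw [← map_succ_top_prod_atTop] at h
  exact h

/-- A family of sequences `f i : ℕ → ℝ` is a symbol of order `μ` with `r` differences if
`Δ ^ j (f i) n = O(n ^ (μ - j))` for all `j ≤ r`, uniformly in `i`. It is the discrete
analogue of the symbols of pseudodifferential calculus, in the variable `n`. -/
def IsSymbol (r : ℕ) (μ : ℤ) (f : ι → ℕ → ℝ) : Prop :=
  ∀ j ≤ r, (fun x : ι × ℕ ↦ Δ_[1] ^[j] (f x.1) x.2) =O[⊤ ×ˢ atTop] fun x ↦ (x.2 : ℝ) ^ (μ - j)

theorem isSymbol_zero_iff {μ : ℤ} {f : ι → ℕ → ℝ} :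
    IsSymbol 0 μ f ↔ (fun x : ι × ℕ ↦ f x.1 x.2) =O[⊤ ×ˢ atTop] fun x ↦ (x.2 : ℝ) ^ μ := by
  simp [IsSymbol]

theorem isSymbol_succ_iff {r : ℕ} {μ : ℤ} {f : ι → ℕ → ℝ} :
    IsSymbol (r + 1) μ f ↔
      (fun x : ι × ℕ ↦ f x.1 x.2) =O[⊤ ×ˢ atTop] (fun x ↦ (x.2 : ℝ) ^ μ) ∧
        IsSymbol r (μ - 1) fun i ↦ Δ_[1] (f i) := by
  have exponent (j : ℕ) : μ - (j + 1 : ℕ) = μ - 1 - j := by push_cast; ring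
  refine ⟨fun h ↦ ⟨by simpa using h 0 (Nat.zero_le _), fun j hj ↦ ?_⟩, fun h j hj ↦ ?_⟩
  · simpa only [exponent, Function.iterate_succ_apply] using h (j + 1) (Nat.succ_le_succ hj)
  · cases j with
    | zero => simpa using h.1
    | succ j =>
      simpa only [exponent, Function.iterate_succ_apply] using h.2 j (Nat.le_of_succ_le_succ hj)

theorem isSymbol_comp_succ_iff {r : ℕ} {μ : ℤ} {f : ι → ℕ → ℝ} :
    IsSymbol r μ (fun i n ↦ f i (n + 1)) ↔ IsSymbol r μ f := by
  refine forall₂_congr fun j _ ↦ ?_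
  have shift_theta : (fun x : ι × ℕ ↦ (x.2 : ℝ) ^ (μ - j)) =Θ[⊤ ×ˢ atTop]
      fun x ↦ ((x.2 + 1 : ℕ) : ℝ) ^ (μ - j) := by
    simpa only [Nat.cast_add_one] using ((isTheta_natCast_add 1).zpow (μ - j)).symm
  simp only [fwdDiff_iter_comp_add]
  rw [shift_theta.isBigO_congr_right]
  nth_rw 2 [← map_succ_top_prod_atTop]
  rw [isBigO_map]
  rfl

namespace IsSymbol

variable {r s : ℕ} {μ ν : ℤ} {f g : ι → ℕ → ℝ}

theorem isBigO (h : IsSymbol r μ f) :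
    (fun x : ι × ℕ ↦ f x.1 x.2) =O[⊤ ×ˢ atTop] fun x ↦ (x.2 : ℝ) ^ μ := by
  simpa using h 0 (Nat.zero_le r)

theorem of_le (h : IsSymbol r μ f) (hs : s ≤ r) : IsSymbol s μ f :=
  fun j hj ↦ h j (hj.trans hs)

theorem congr' (h : IsSymbol r μ f) (hfg : ∀ᶠ x : ι × ℕ in ⊤ ×ˢ atTop, f x.1 x.2 = g x.1 x.2) :
    IsSymbol r μ g := by
  induction r generalizing μ f g with
  | zero => exact isSymbol_zero_iff.2 (h.isBigO.congr' hfg .rfl)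
  | succ r ih =>
    obtain ⟨hf, hΔf⟩ := isSymbol_succ_iff.1 h
    refine isSymbol_succ_iff.2 ⟨hf.congr' hfg .rfl, ih hΔf ?_⟩
    filter_upwards [hfg, eventually_comp_succ hfg] with x hx hx'
    simp only [fwdDiff, hx, hx']

theorem comp_succ (h : IsSymbol r μ f) : IsSymbol r μ fun i n ↦ f i (n + 1) :=
  isSymbol_comp_succ_iff.2 h

theorem add (hf : IsSymbol r μ f) (hg : IsSymbol r μ g) : IsSymbol r μ fun i ↦ f i + g i := by
  intro j hj
  simp only [fwdDiff_iter_add]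
  exact (hf j hj).add (hg j hj)

theorem const_mul (c : ℝ) (h : IsSymbol r μ f) : IsSymbol r μ fun i ↦ c • f i := by
  intro j hj
  simp only [fwdDiff_iter_const_smul]
  exact (h j hj).const_mul_left c

theorem const (c : ℝ) : IsSymbol r 0 fun (_ : ι) _ ↦ c := by
  intro j _
  cases j with
  | zero => simpa using isBigO_const_const c (one_ne_zero (α := ℝ)) _
  | succ j =>
    have iterate_eq_zero : Δ_[1] ^[j] (fun _ : ℕ ↦ (0 : ℝ)) = 0 :=
      Function.iterate_fixed (fwdDiff_const 1 0) j
    simp only [Function.iterate_succ_apply, fwdDiff_const, iterate_eq_zero]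
    exact isBigO_zero _ _

theorem mul (hf : IsSymbol r μ f) (hg : IsSymbol r ν g) :
    IsSymbol r (μ + ν) fun i n ↦ f i n * g i n := by
  have product_isBigO := (hf.isBigO.mul hg.isBigO).trans_eventuallyEq
    (zpow_mul_zpow_eventuallyEq μ ν)
  induction r generalizing μ ν f g with
  | zero => exact isSymbol_zero_iff.2 product_isBigO
  | succ r ih =>
    have hΔf := (isSymbol_succ_iff.1 hf).2
    have hΔg := (isSymbol_succ_iff.1 hg).2
    have hf' := hf.of_le r.le_succ
    have hg' := (hg.of_le r.le_succ).comp_succ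
    have leibniz : (fun i ↦ Δ_[1] (fun n ↦ f i n * g i n)) =
        fun i ↦ (fun n ↦ Δ_[1] (f i) n * g i (n + 1)) + fun n ↦ f i n * Δ_[1] (g i) n := by
      ext i n
      simp only [fwdDiff, Pi.add_apply]
      ring
    have h₁ := ih hΔf hg' ((hΔf.isBigO.mul hg'.isBigO).trans_eventuallyEq
      (zpow_mul_zpow_eventuallyEq _ _))
    have h₂ := ih hf' hΔg ((hf'.isBigO.mul hΔg.isBigO).trans_eventuallyEq
      (zpow_mul_zpow_eventuallyEq _ _))
    rw [sub_add_eq_add_sub] at h₁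
    rw [← add_sub_assoc] at h₂
    exact isSymbol_succ_iff.2 ⟨product_isBigO, leibniz ▸ h₁.add h₂⟩

end IsSymbol

theorem eventually_ne_zero_of_zpow_isBigO {μ : ℤ} {f : ι × ℕ → ℝ}
    (h : (fun x : ι × ℕ ↦ (x.2 : ℝ) ^ μ) =O[⊤ ×ˢ atTop] f) :
    ∀ᶠ x in ⊤ ×ˢ atTop, f x ≠ 0 := by
  filter_upwards [h.eq_zero_imp, eventually_natCast_snd_pos] with x hx hpos h0
  exact (zpow_pos hpos μ).ne' (hx h0)

namespace IsSymbol

variable {r : ℕ} {μ : ℤ} {f : ι → ℕ → ℝ}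

theorem inv (hf : IsSymbol r μ f)
    (h : (fun x : ι × ℕ ↦ (x.2 : ℝ) ^ μ) =O[⊤ ×ˢ atTop] fun x ↦ f x.1 x.2) :
    IsSymbol r (-μ) fun i n ↦ (f i n)⁻¹ := by
  have inv_isBigO : (fun x : ι × ℕ ↦ (f x.1 x.2)⁻¹) =O[⊤ ×ˢ atTop]
      fun x ↦ (x.2 : ℝ) ^ (-μ) := by
    simpa only [zpow_neg] using h.inv_rev
      (eventually_natCast_snd_pos.mono fun x hx h0 ↦ absurd h0 (zpow_pos hx μ).ne')
  induction r with
  | zero => exact isSymbol_zero_iff.2 inv_isBigO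
  | succ r ih =>
    have hinv := ih (hf.of_le r.le_succ)
    have hΔ := ((isSymbol_succ_iff.1 hf).2.mul (hinv.mul hinv.comp_succ)).const_mul (-1)
    rw [show μ - 1 + (-μ + -μ) = -μ - 1 by ring] at hΔ
    refine isSymbol_succ_iff.2 ⟨inv_isBigO, hΔ.congr' ?_⟩
    have hne := eventually_ne_zero_of_zpow_isBigO h
    filter_upwards [hne, eventually_comp_succ hne] with x hx hx'
    simp only [fwdDiff, Pi.smul_apply, smul_eq_mul]
    field_simp
    ring

theorem sqrt (hf : IsSymbol r (2 * μ) f)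
    (h : (fun x : ι × ℕ ↦ (x.2 : ℝ) ^ (2 * μ)) =O[⊤ ×ˢ atTop] fun x ↦ f x.1 x.2)
    (hnonneg : ∀ i n, 0 ≤ f i n) : IsSymbol r μ fun i n ↦ √(f i n) := by
  have sqrt_zpow (x : ι × ℕ) : √((x.2 : ℝ) ^ (2 * μ)) = (x.2 : ℝ) ^ μ := by
    rw [mul_comm, zpow_mul, zpow_ofNat, Real.sqrt_sq (by positivity)]
  have sqrt_isBigO : (fun x : ι × ℕ ↦ √(f x.1 x.2)) =O[⊤ ×ˢ atTop]
      fun x ↦ (x.2 : ℝ) ^ μ := by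
    simpa only [sqrt_zpow] using hf.isBigO.sqrt (.of_forall fun x ↦ by positivity)
  have isBigO_sqrt : (fun x : ι × ℕ ↦ (x.2 : ℝ) ^ μ) =O[⊤ ×ˢ atTop]
      fun x ↦ √(f x.1 x.2) := by
    simpa only [sqrt_zpow] using h.sqrt (.of_forall fun x ↦ hnonneg x.1 x.2)
  induction r with
  | zero => exact isSymbol_zero_iff.2 sqrt_isBigO
  | succ r ih =>
    have hsqrt := ih (hf.of_le r.le_succ)
    have isBigO_sum : (fun x : ι × ℕ ↦ √(f x.1 x.2)) =O[⊤ ×ˢ atTop]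
        fun x ↦ √(f x.1 x.2) + √(f x.1 (x.2 + 1)) := by
      refine .of_bound' (.of_forall fun x ↦ ?_)
      rw [Real.norm_of_nonneg (by positivity), Real.norm_of_nonneg (by positivity)]
      exact le_add_of_nonneg_right (Real.sqrt_nonneg _)
    have hΔ := (isSymbol_succ_iff.1 hf).2.mul
      ((hsqrt.add hsqrt.comp_succ).inv (isBigO_sqrt.trans isBigO_sum))
    rw [show 2 * μ - 1 + -μ = μ - 1 by ring] at hΔ
    refine isSymbol_succ_iff.2 ⟨sqrt_isBigO, hΔ.congr' ?_⟩
    filter_upwards [eventually_ne_zero_of_zpow_isBigO isBigO_sqrt] with x hx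
    have : 0 < √(f x.1 x.2) := (Real.sqrt_nonneg _).lt_of_ne' hx
    simp only [fwdDiff, Pi.add_apply]
    rw [← div_eq_mul_inv, div_eq_iff (by positivity)]
    linear_combination Real.sq_sqrt (hnonneg x.1 x.2) - Real.sq_sqrt (hnonneg x.1 (x.2 + 1))

end IsSymbol

theorem isSymbol_natCast_add (r : ℕ) (a : ℝ) : IsSymbol r 1 fun (_ : ι) n ↦ (n : ℝ) + a := by
  have hbigO := (isTheta_natCast_add (ι := ι) a).isBigO
  cases r with
  | zero => exact isSymbol_zero_iff.2 (by simpa using hbigO)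
  | succ r =>
    have hΔ : (fun _ : ι ↦ Δ_[1] fun n : ℕ ↦ (n : ℝ) + a) = fun _ _ ↦ 1 := by
      ext _ n
      simp only [fwdDiff]
      push_cast
      ring
    refine isSymbol_succ_iff.2 ⟨by simpa using hbigO, ?_⟩
    rw [hΔ]
    exact .const 1

theorem isSymbol_prod_natCast_add {α : Type*} (s : Finset α) (a : α → ℝ) (r : ℕ) :
    IsSymbol r s.card fun (_ : ι) n ↦ ∏ i ∈ s, ((n : ℝ) + a i) := by
  classical
  induction s using Finset.induction_on with
  | empty => simpa using IsSymbol.const 1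
  | insert i s hi ih =>
    simp only [Finset.prod_insert hi, Finset.card_insert_of_notMem hi]
    simpa only [Nat.cast_add_one, add_comm (1 : ℤ)] using (isSymbol_natCast_add r (a i)).mul ih

theorem isTheta_prod_natCast_add {α : Type*} (s : Finset α) (a : α → ℝ) :
    (fun x : ι × ℕ ↦ ∏ i ∈ s, ((x.2 : ℝ) + a i)) =Θ[⊤ ×ˢ atTop]
      fun x ↦ (x.2 : ℝ) ^ (s.card : ℤ) := by
  simpa using IsTheta.finsetProd (s := s) fun i _ ↦ isTheta_natCast_add (ι := ι) (a i)

end Symbol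

section Sampling

theorem fwdDiff_iter_comp_natCast_mul {R G : Type*} [Semiring R] [AddCommGroup G] (F : R → G)
    (h : R) (j n : ℕ) :
    Δ_[1] ^[j] (fun n : ℕ ↦ F (n * h)) n = Δ_[h] ^[j] F (n * h) := by
  simp only [fwdDiff_iter_eq_sum_shift, nsmul_eq_mul, mul_one, Nat.cast_add,
    Nat.cast_id, add_mul]

variable {E : Type*} [NormedAddCommGroup E] [NormedSpace ℝ E]

theorem norm_fwdDiff_iter_le {j : ℕ} {F : ℝ → E} (hF : ContDiff ℝ j F) {C : ℝ}
    (hC : ∀ t, ‖iteratedDeriv j F t‖ ≤ C) (h t : ℝ) : ‖Δ_[h] ^[j] F t‖ ≤ C * |h| ^ j := by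
  induction j generalizing F C with
  | zero => simpa using hC t
  | succ j ih =>
    have hFj : ContDiff ℝ j F := hF.of_le (mod_cast j.le_succ)
    have hFj_shift : ContDiff ℝ j fun s ↦ F (s + h) := hFj.comp (contDiff_id.add contDiff_const)
    have deriv_le (s : ℝ) : ‖iteratedDeriv j (Δ_[h] F) s‖ ≤ C * |h| := by
      have hderiv : iteratedDeriv j (Δ_[h] F) s =
          iteratedDeriv j F (s + h) - iteratedDeriv j F s := by
        rw [show Δ_[h] F = fun s ↦ F (s + h) - F s from rfl,
          iteratedDeriv_fun_sub hFj_shift.contDiffAt hFj.contDiffAt, iteratedDeriv_comp_add_const]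
      have hmean := convex_univ.norm_image_sub_le_of_norm_deriv_le (f := iteratedDeriv j F)
        (fun y _ ↦ hF.differentiable_iteratedDeriv j (mod_cast j.lt_succ_self) y)
        (fun y _ ↦ by rw [← iteratedDeriv_succ]; exact hC y) (mem_univ s) (mem_univ (s + h))
      rwa [add_sub_cancel_left, ← hderiv] at hmean
    rw [Function.iterate_succ_apply]
    calc ‖Δ_[h] ^[j] (Δ_[h] F) t‖ ≤ C * |h| * |h| ^ j := ih (hFj_shift.sub hFj) deriv_le
      _ = C * |h| ^ (j + 1) := by ring

theorem exists_norm_iteratedDeriv_le {j : ℕ} {F : ℝ → E} (hF : ContDiff ℝ j F)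
    (hsupp : HasCompactSupport F) : ∃ C, ∀ t, ‖iteratedDeriv j F t‖ ≤ C := by
  simp only [← norm_iteratedFDeriv_eq_norm_iteratedDeriv]
  exact (hF.continuous_iteratedFDeriv le_rfl).bounded_above_of_compact_support
    (hsupp.iteratedFDeriv j)

theorem isSymbol_sample {r : ℕ} {F : ℝ → ℝ} (hF : ContDiff ℝ r F) (hsupp : HasCompactSupport F) :
    IsSymbol r 0 fun (N n : ℕ) ↦ F (n / N) := by
  obtain ⟨b, hb⟩ : ∃ b : ℝ, ∀ t > b, F t = 0 := by
    obtain ⟨b, hb⟩ := hsupp.isCompact.bddAbove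
    exact ⟨b, fun t ht ↦ image_eq_zero_of_notMem_tsupport fun hmem ↦ ht.not_ge (hb hmem)⟩
  intro j hj
  have hFj : ContDiff ℝ j F := hF.of_le (mod_cast hj)
  obtain ⟨C, hC⟩ := exists_norm_iteratedDeriv_le hFj hsupp
  have hC0 : 0 ≤ C := (norm_nonneg _).trans (hC 0)
  simp only [zero_sub, zpow_neg, zpow_natCast, div_eq_mul_inv, fwdDiff_iter_comp_natCast_mul]
  refine .of_bound (C * |b| ^ j) (eventually_natCast_snd_pos.mono fun ⟨N, n⟩ hn ↦ ?_)
  have hn : (0 : ℝ) < n := hn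
  have hN : (0 : ℝ) ≤ (N : ℝ)⁻¹ := by positivity
  rcases lt_or_ge b (n * (N : ℝ)⁻¹) with hb' | hb'
  · have samples_eq_zero : Δ_[(N : ℝ)⁻¹] ^[j] F (n * (N : ℝ)⁻¹) = 0 := by
      rw [fwdDiff_iter_eq_sum_shift]
      refine Finset.sum_eq_zero fun i _ ↦ ?_
      rw [hb _ (hb'.trans_le (le_add_of_nonneg_right (nsmul_nonneg hN i))), smul_zero]
    rw [samples_eq_zero, norm_zero]
    positivity
  · have step_le : (N : ℝ)⁻¹ ≤ |b| * (n : ℝ)⁻¹ := by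
      rw [← div_eq_mul_inv, le_div_iff₀' hn]
      exact hb'.trans (le_abs_self b)
    calc ‖Δ_[(N : ℝ)⁻¹] ^[j] F (n * (N : ℝ)⁻¹)‖ ≤ C * |(N : ℝ)⁻¹| ^ j :=
          norm_fwdDiff_iter_le hFj hC _ _
      _ ≤ C * (|b| * (n : ℝ)⁻¹) ^ j := by
          rw [abs_of_nonneg hN]
          gcongr
      _ = C * |b| ^ j * ‖((n : ℝ) ^ j)⁻¹‖ := by
          rw [Real.norm_of_nonneg (by positivity), mul_pow, inv_pow, mul_assoc]

end Sampling

/-! ### Decay of differentiated Legendre series -/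

section LegendreStep

/-- The operator on coefficient sequences that corresponds to multiplication of
`∑ n, (2 * n + 1) * g n * (d / dx) ^ k P_n` by `1 - x`. The coefficient `n - k` of `g (n - 1)`
is harmless at `n = 0`: there `(d / dx) ^ k P_0 = 0` unless `k = 0`. -/
noncomputable def legendreStep (k : ℕ) (g : ℕ → ℝ) (n : ℕ) : ℝ :=
  g n - (((n : ℝ) - k) * g (n - 1) + ((n : ℝ) + 1 + k) * g (n + 1)) / (2 * n + 1)

theorem legendreStep_succ (k : ℕ) (g : ℕ → ℝ) (n : ℕ) :
    legendreStep k g (n + 1) = (-1 / 2) * Δ_[1] (Δ_[1] g) n +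
      (-(2 * k + 1) / 4) * (((n : ℝ) + 3 / 2)⁻¹ * (Δ_[1] g n + Δ_[1] g (n + 1))) := by
  have : 2 * ((n : ℝ) + 1) + 1 ≠ 0 := by positivity
  have : (n : ℝ) + 3 / 2 ≠ 0 := by positivity
  simp only [legendreStep, fwdDiff, Nat.add_sub_cancel]
  push_cast
  field_simp
  ring

theorem IsSymbol.legendreStep {ι : Type*} {r : ℕ} {μ : ℤ} {g : ι → ℕ → ℝ} (k : ℕ)
    (hg : IsSymbol (r + 2) μ g) : IsSymbol r (μ - 2) fun i ↦ legendreStep k (g i) := by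
  have hΔ : IsSymbol (r + 1) (μ - 1) fun i ↦ Δ_[1] (g i) := (isSymbol_succ_iff.1 hg).2
  have hΔΔ : IsSymbol r (μ - 2) fun i ↦ Δ_[1] (Δ_[1] (g i)) := by
    simpa only [sub_sub, one_add_one_eq_two] using (isSymbol_succ_iff.1 hΔ).2
  have hinv : IsSymbol r (-1) fun (_ : ι) n ↦ ((n : ℝ) + 3 / 2)⁻¹ :=
    (isSymbol_natCast_add r _).inv (by simpa using (isTheta_natCast_add _).symm.isBigO)
  have hΔ' := hΔ.of_le r.le_succ
  have hfirst := hinv.mul (hΔ'.add hΔ'.comp_succ)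
  rw [show -1 + (μ - 1) = μ - 2 by ring] at hfirst
  rw [← isSymbol_comp_succ_iff]
  simp only [legendreStep_succ]
  exact (hΔΔ.const_mul (-1 / 2)).add (hfirst.const_mul (-(2 * k + 1) / 4))

theorem IsSymbol.iterate_legendreStep {ι : Type*} {r m : ℕ} {μ : ℤ} {g : ι → ℕ → ℝ} (k : ℕ)
    (hg : IsSymbol (r + 2 * m) μ g) :
    IsSymbol r (μ - 2 * m) fun i ↦ (DirectionalWavelet.legendreStep k)^[m] (g i) := by
  induction m generalizing μ g with
  | zero => simpa using hg
  | succ m ih =>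
    simp only [Function.iterate_succ_apply]
    rw [show μ - 2 * ((m + 1 : ℕ) : ℤ) = μ - 2 - 2 * m by push_cast; ring]
    exact ih (IsSymbol.legendreStep k hg)

theorem iterate_legendreStep_eq_zero_of_ge {k m M : ℕ} {g : ℕ → ℝ} (hg : ∀ n ≥ M, g n = 0)
    {n : ℕ} (hn : M + m ≤ n) : (legendreStep k)^[m] g n = 0 := by
  induction m generalizing M g with
  | zero => exact hg n hn
  | succ m ih =>
    refine ih (M := M + 1) (fun n hn ↦ ?_) (by omega)
    simp [legendreStep, hg n (by omega), hg (n - 1) (by omega), hg (n + 1) (by omega)]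

theorem iterate_legendreStep_eq_zero_of_lt {k m M : ℕ} {g : ℕ → ℝ} (hg : ∀ n < M, g n = 0)
    {n : ℕ} (hn : n + m < M) : (legendreStep k)^[m] g n = 0 := by
  induction m generalizing M g with
  | zero => exact hg n hn
  | succ m ih =>
    refine ih (M := M - 1) (fun n hn ↦ ?_) (by omega)
    simp [legendreStep, hg n (by omega), hg (n - 1) (by omega), hg (n + 1) (by omega)]

/-- The partial sum `∑ n < M, (2 * n + 1) * g n * (d / dx) ^ k P_n` of a differentiated Legendre
series, normalized so that `g n` is the coefficient with respect to the reproducing kernels. -/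
noncomputable def legendreSum (k M : ℕ) (g : ℕ → ℝ) : ℝ[X] :=
  ∑ n ∈ Finset.range M, C ((2 * n + 1) * g n) * derivative^[k] (legendreP n)

theorem eval_legendreSum (k M : ℕ) (g : ℕ → ℝ) (x : ℝ) :
    (legendreSum k M g).eval x =
      ∑ n ∈ Finset.range M, (2 * n + 1) * g n * (derivative^[k] (legendreP n)).eval x := by
  simp only [legendreSum, eval_finsetSum, eval_mul, eval_C]

theorem legendreSum_eq_of_le {k M M' : ℕ} {g : ℕ → ℝ} (hg : ∀ n ≥ M, g n = 0) (h : M ≤ M') :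
    legendreSum k M' g = legendreSum k M g := by
  refine (Finset.sum_subset (Finset.range_mono h) fun n _ hn ↦ ?_).symm
  rw [hg n (by simpa using hn), mul_zero, C_0, zero_mul]

theorem one_sub_mul_eval_legendreSum_sub (k M : ℕ) (g : ℕ → ℝ) (x : ℝ) :
    (1 - x) * (legendreSum k (M + 1) g).eval x -
        (legendreSum k (M + 1) (legendreStep k g)).eval x =
      ((M : ℝ) + 1 + k) * g (M + 1) * (derivative^[k] (legendreP M)).eval x -
        ((M : ℝ) + 1 - k) * g M * (derivative^[k] (legendreP (M + 1))).eval x := by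
  simp only [eval_legendreSum]
  induction M with
  | zero =>
    simp only [zero_add, Finset.sum_range_one, legendreStep]
    match k with
    | 0 => simp [legendreP_zero, legendreP_one]; ring
    | 1 => simp [legendreP_zero]
    | k + 2 => simp [legendreP_zero, legendreP_one, Function.iterate_succ_apply]
  | succ M ih =>
    have three_term := congrArg (eval x) (iterate_derivative_legendreP_three_term M k)
    simp only [eval_mul, eval_sub, eval_add, eval_natCast, eval_ofNat, eval_one, eval_X]
      at three_term
    have hM : 2 * ((M + 1 : ℕ) : ℝ) + 1 ≠ 0 := by positivity
    rw [Finset.sum_range_succ, Finset.sum_range_succ _ (M + 1), mul_add, add_sub_add_comm, ih]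
    simp only [legendreStep, Nat.add_sub_cancel]
    field_simp
    push_cast
    linear_combination g (M + 1) * three_term

theorem one_sub_X_mul_legendreSum {k M : ℕ} {g : ℕ → ℝ} (hg : ∀ n ≥ M, g n = 0) :
    (1 - X) * legendreSum k M g = legendreSum k (M + 1) (legendreStep k g) := by
  refine Polynomial.funext fun x ↦ ?_
  have h := one_sub_mul_eval_legendreSum_sub k M g x
  rw [hg M le_rfl, hg (M + 1) M.le_succ, legendreSum_eq_of_le hg M.le_succ] at h
  simp only [eval_mul, eval_sub, eval_one, eval_X]
  linear_combination h

theorem one_sub_X_pow_mul_legendreSum {k M : ℕ} (m : ℕ) {g : ℕ → ℝ} (hg : ∀ n ≥ M, g n = 0) :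
    (1 - X) ^ m * legendreSum k M g = legendreSum k (M + m) ((legendreStep k)^[m] g) := by
  induction m with
  | zero => simp
  | succ m ih =>
    rw [pow_succ', mul_assoc, ih, one_sub_X_mul_legendreSum fun n ↦
      iterate_legendreStep_eq_zero_of_ge hg, Function.iterate_succ_apply', add_assoc]

end LegendreStep

section Localization

theorem zpow_le_zpow_add_zpow {a b t : ℝ} (ha : 0 < a) (ht : t ∈ Icc a b) (e : ℤ) :
    t ^ e ≤ a ^ e + b ^ e := by
  have ht₀ : 0 < t := ha.trans_le ht.1
  have hb : 0 < b := ht₀.trans_le ht.2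
  obtain ⟨n, rfl | rfl⟩ := e.eq_nat_or_neg
  · simp only [zpow_natCast]
    exact (pow_le_pow_left₀ ht₀.le ht.2 n).trans (le_add_of_nonneg_left (by positivity))
  · simp only [zpow_neg, zpow_natCast]
    exact (inv_anti₀ (by positivity) (pow_le_pow_left₀ ha.le ht.1 n)).trans
      (le_add_of_nonneg_right (by positivity))

theorem norm_toContinuousMapOn_le_iff {p : ℝ[X]} {C : ℝ} (hC : 0 ≤ C) :
    ‖p.toContinuousMapOn (Icc (-1) 1)‖ ≤ C ↔ ∀ x ∈ Icc (-1 : ℝ) 1, |p.eval x| ≤ C := by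
  rw [ContinuousMap.norm_le _ hC, Subtype.forall]
  rfl

theorem abs_eval_legendreSum_le (k M : ℕ) (g : ℕ → ℝ) {x : ℝ} (hx : x ∈ Icc (-1 : ℝ) 1) :
    |(legendreSum k M g).eval x| ≤
      ∑ n ∈ Finset.range M, (2 * n + 1) * |g n| * (n : ℝ) ^ (2 * k) := by
  rw [eval_legendreSum]
  refine (Finset.abs_sum_le_sum_abs _ _).trans (Finset.sum_le_sum fun n _ ↦ ?_)
  rw [abs_mul, abs_mul, abs_of_nonneg (show 0 ≤ 2 * (n : ℝ) + 1 by positivity)]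
  gcongr
  exact abs_eval_iterate_derivative_legendreP_le k n hx

theorem sum_range_mul_abs_mul_pow_le {h : ℕ → ℝ} {ν : ℤ} {M : ℕ} {C α β R : ℝ} (k : ℕ)
    (hα : 0 < α) (hC : 0 ≤ C) (hR : 0 < R) (hlow : ∀ n : ℕ, (n : ℝ) < α * R → h n = 0)
    (hbound : ∀ n : ℕ, α * R ≤ n → |h n| ≤ C * (n : ℝ) ^ ν) (hM : (M : ℝ) ≤ β * R) :
    ∑ n ∈ Finset.range M, (2 * n + 1) * |h n| * (n : ℝ) ^ (2 * k) ≤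
      β * (3 * C * (α ^ (ν + 2 * k + 1) + β ^ (ν + 2 * k + 1))) * R ^ (ν + 2 * k + 2) := by
  have hβ : 0 ≤ β := nonneg_of_mul_nonneg_left (M.cast_nonneg.trans hM) hR
  rw [show ν + 2 * k + 2 = ν + 2 * k + 1 + 1 by ring]
  generalize he : ν + 2 * k + 1 = e
  have term_le (n : ℕ) (hn : n ∈ Finset.range M) :
      (2 * n + 1) * |h n| * (n : ℝ) ^ (2 * k) ≤ 3 * C * (α ^ e + β ^ e) * R ^ e := by
    rcases lt_or_ge (n : ℝ) (α * R) with hnα | hnα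
    · rw [hlow n hnα, abs_zero, mul_zero, zero_mul]
      positivity
    have hn_one : (1 : ℝ) ≤ n :=
      Nat.one_le_cast.2 (Nat.cast_pos.1 ((mul_pos hα hR).trans_le hnα))
    have hnβ : (n : ℝ) ≤ β * R := (Nat.cast_le.2 (Finset.mem_range.1 hn).le).trans hM
    calc (2 * n + 1) * |h n| * (n : ℝ) ^ (2 * k)
        ≤ (3 * n) * (C * (n : ℝ) ^ ν) * (n : ℝ) ^ (2 * k) := by
          gcongr
          · linarith
          · exact hbound n hnα
      _ = 3 * C * (n : ℝ) ^ e := by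
          rw [← he, zpow_add_one₀ (by positivity), zpow_add₀ (by positivity),
            show (2 * k : ℤ) = (2 * k : ℕ) by push_cast; rfl, zpow_natCast]
          ring
      _ ≤ 3 * C * ((α * R) ^ e + (β * R) ^ e) := by
          gcongr
          exact zpow_le_zpow_add_zpow (by positivity) ⟨hnα, hnβ⟩ e
      _ = 3 * C * (α ^ e + β ^ e) * R ^ e := by
          rw [mul_zpow, mul_zpow]
          ring
  calc _ ≤ M * (3 * C * (α ^ e + β ^ e) * R ^ e) := by
        simpa using Finset.sum_le_card_nsmul _ _ _ term_le
    _ ≤ β * R * (3 * C * (α ^ e + β ^ e) * R ^ e) := by gcongr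
    _ = β * (3 * C * (α ^ e + β ^ e)) * R ^ (e + 1) := by
        rw [zpow_add_one₀ hR.ne']
        ring

theorem exists_abs_le_of_isBigO_zpow {ι : Type*} {h : ι → ℕ → ℝ} {ν : ℤ}
    (hh : (fun x : ι × ℕ ↦ h x.1 x.2) =O[⊤ ×ˢ atTop] fun x ↦ (x.2 : ℝ) ^ ν) :
    ∃ C ≥ 0, ∃ n₀ : ℕ, ∀ i, ∀ n ≥ n₀, |h i n| ≤ C * (n : ℝ) ^ ν := by
  obtain ⟨C, hC, hbound⟩ := hh.exists_nonneg
  have hev := hbound.bound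
  rw [top_prod, eventually_comap, eventually_atTop] at hev
  obtain ⟨n₀, hn₀⟩ := hev
  refine ⟨C, hC, n₀, fun i n hn ↦ ?_⟩
  simpa only [norm_zpow, RCLike.norm_natCast, Real.norm_eq_abs] using hn₀ n hn (i, n) rfl

theorem legendreSum_isBigO {h : ℕ → ℕ → ℝ} {ν : ℤ} {M : ℕ → ℕ} {α β : ℝ} (k : ℕ) (hα : 0 < α)
    (hh : (fun x : ℕ × ℕ ↦ h x.1 x.2) =O[⊤ ×ˢ atTop] fun x ↦ (x.2 : ℝ) ^ ν)
    (hlow : ∀ᶠ N : ℕ in atTop, ∀ n : ℕ, (n : ℝ) < α * N → h N n = 0)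
    (hM : ∀ᶠ N : ℕ in atTop, (M N : ℝ) ≤ β * N) :
    (fun N ↦ (legendreSum k (M N) (h N)).toContinuousMapOn (Icc (-1) 1)) =O[atTop]
      fun N ↦ (N : ℝ) ^ (ν + 2 * k + 2) := by
  obtain ⟨C, hC, n₀, hn₀⟩ := exists_abs_le_of_isBigO_zpow hh
  refine .of_bound (β * (3 * C * (α ^ (ν + 2 * k + 1) + β ^ (ν + 2 * k + 1)))) ?_
  have hlarge : ∀ᶠ N : ℕ in atTop, (n₀ : ℝ) ≤ α * N :=
    (tendsto_natCast_atTop_atTop.const_mul_atTop hα).eventually_ge_atTop _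
  filter_upwards [hlow, hM, hlarge, eventually_gt_atTop 0] with N hlow hM hlarge hN
  replace hN : (0 : ℝ) < N := Nat.cast_pos.2 hN
  have hβ : 0 ≤ β := nonneg_of_mul_nonneg_left ((M N).cast_nonneg.trans hM) hN
  rw [Real.norm_of_nonneg (by positivity), norm_toContinuousMapOn_le_iff (by positivity)]
  exact fun x hx ↦ (abs_eval_legendreSum_le k _ _ hx).trans <|
    sum_range_mul_abs_mul_pow_le k hα hC hN hlow
      (fun n hn ↦ hn₀ N n (Nat.cast_le.1 (hlarge.trans hn))) hM

variable {g : ℕ → ℕ → ℝ} {μ : ℤ} {a : ℝ} {b : ℕ}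

theorem one_sub_X_pow_mul_legendreSum_isBigO (k m : ℕ) (ha : 0 < a)
    (hg : IsSymbol (2 * m) μ g) (hlow : ∀ N n : ℕ, (n : ℝ) < a * N → g N n = 0)
    (hhigh : ∀ N n : ℕ, b * N < n → g N n = 0) :
    (fun N : ℕ ↦ ((1 - X) ^ m * legendreSum k (b * N + 1) (g N)).toContinuousMapOn (Icc (-1) 1))
      =O[atTop] fun N : ℕ ↦ (N : ℝ) ^ (μ - 2 * m + 2 * k + 2) := by
  have hsum (N : ℕ) : (1 - X) ^ m * legendreSum k (b * N + 1) (g N) =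
      legendreSum k (b * N + 1 + m) ((legendreStep k)^[m] (g N)) :=
    one_sub_X_pow_mul_legendreSum m fun n ↦ hhigh N n
  have hdecay : IsSymbol 0 (μ - 2 * m) fun N ↦ (legendreStep k)^[m] (g N) :=
    .iterate_legendreStep k (by rwa [zero_add])
  simp only [hsum]
  refine legendreSum_isBigO (α := a / 2) (β := b + 1) k (half_pos ha) hdecay.isBigO ?_ ?_
  · filter_upwards [(tendsto_natCast_atTop_atTop.const_mul_atTop (half_pos ha)).eventually_ge_atTop
      (m : ℝ)] with N hN n hn
    refine iterate_legendreStep_eq_zero_of_lt (M := ⌈a * N⌉₊)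
      (fun n hn ↦ hlow N n (Nat.lt_ceil.1 hn)) (Nat.lt_ceil.2 ?_)
    push_cast
    linarith
  · filter_upwards [eventually_ge_atTop (m + 1)] with N hN
    have hN : (m : ℝ) + 1 ≤ N := mod_cast hN
    push_cast
    linarith

theorem exists_one_sub_pow_mul_abs_eval_legendreSum_le (k m : ℕ) (ha : 0 < a)
    (hg : IsSymbol (2 * m) μ g) (hlow : ∀ N n : ℕ, (n : ℝ) < a * N → g N n = 0)
    (hhigh : ∀ N n : ℕ, b * N < n → g N n = 0) :
    ∃ C > 0, ∀ N : ℕ, 1 ≤ N → ∀ x ∈ Icc (-1 : ℝ) 1,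
      (1 - x) ^ m * |(legendreSum k (b * N + 1) (g N)).eval x| ≤
        C * (N : ℝ) ^ (μ - 2 * m + 2 * k + 2) := by
  obtain ⟨C, hC, hbound⟩ := bound_of_isBigO_nat_atTop
    (one_sub_X_pow_mul_legendreSum_isBigO k m ha hg hlow hhigh)
  refine ⟨C, hC, fun N hN x hx ↦ ?_⟩
  have : (0 : ℝ) < N := Nat.cast_pos.2 hN
  have h := hbound (x := N) (by positivity)
  rw [Real.norm_of_nonneg (by positivity), norm_toContinuousMapOn_le_iff (by positivity)] at h
  simpa [abs_mul, abs_of_nonneg (sub_nonneg.2 hx.2)] using h x hx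

theorem sq_le_mul_one_sub_cos {θ : ℝ} (hθ : |θ| ≤ Real.pi) :
    θ ^ 2 ≤ Real.pi ^ 2 / 2 * (1 - Real.cos θ) := by
  have h := Real.cos_le_one_sub_mul_cos_sq hθ
  calc θ ^ 2 = Real.pi ^ 2 / 2 * (2 / Real.pi ^ 2 * θ ^ 2) := by field_simp
    _ ≤ Real.pi ^ 2 / 2 * (1 - Real.cos θ) := by gcongr; linarith

theorem mul_one_add_pow_le {S t A B : ℝ} {q l : ℕ} (hS : 0 ≤ S) (ht : 0 ≤ t) (hq : q ≤ l)
    (near : S ≤ A) (far : t ^ l * S ≤ B) : S * (1 + t) ^ q ≤ 2 ^ (l - 1) * (A + B) := by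
  calc S * (1 + t) ^ q ≤ S * (2 ^ (l - 1) * (1 ^ l + t ^ l)) := by
        gcongr
        exact (pow_le_pow_right₀ (by linarith) hq).trans (add_pow_le zero_le_one ht _)
    _ = 2 ^ (l - 1) * (S + t ^ l * S) := by ring
    _ ≤ 2 ^ (l - 1) * (A + B) := by gcongr

theorem exists_abs_eval_cos_legendreSum_mul_le {q m : ℕ} (k : ℕ) (hq : q ≤ 2 * m) (ha : 0 < a)
    (hg : IsSymbol (2 * m) μ g) (hlow : ∀ N n : ℕ, (n : ℝ) < a * N → g N n = 0)
    (hhigh : ∀ N n : ℕ, b * N < n → g N n = 0) :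
    ∃ C > 0, ∀ N : ℕ, 1 ≤ N → ∀ θ ∈ Icc 0 Real.pi,
      |(legendreSum k (b * N + 1) (g N)).eval (Real.cos θ)| * (1 + N * θ) ^ q ≤
        C * (N : ℝ) ^ (μ + 2 * k + 2) := by
  obtain ⟨C₀, hC₀, h₀⟩ := exists_one_sub_pow_mul_abs_eval_legendreSum_le k 0 ha
    (hg.of_le (Nat.zero_le _)) hlow hhigh
  obtain ⟨C, hC, h⟩ := exists_one_sub_pow_mul_abs_eval_legendreSum_le k m ha hg hlow hhigh
  refine ⟨2 ^ (2 * m - 1) * (C₀ + (Real.pi ^ 2 / 2) ^ m * C), by positivity, fun N hN θ hθ ↦ ?_⟩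
  have hN₀ : (0 : ℝ) < N := Nat.cast_pos.2 hN
  have hcos : Real.cos θ ∈ Icc (-1 : ℝ) 1 := Real.cos_mem_Icc θ
  set S := |(legendreSum k (b * N + 1) (g N)).eval (Real.cos θ)|
  have near : S ≤ C₀ * (N : ℝ) ^ (μ + 2 * k + 2) := by simpa using h₀ N hN _ hcos
  have hm : (1 - Real.cos θ) ^ m * S ≤ C * (N : ℝ) ^ (μ - 2 * m + 2 * k + 2) := h N hN _ hcos
  have far : (N * θ) ^ (2 * m) * S ≤ (Real.pi ^ 2 / 2) ^ m * C * (N : ℝ) ^ (μ + 2 * k + 2) := by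
    calc (N * θ) ^ (2 * m) * S = (N : ℝ) ^ (2 * m) * ((θ ^ 2) ^ m * S) := by
          rw [mul_pow, pow_mul θ, mul_assoc]
      _ ≤ (N : ℝ) ^ (2 * m) * ((Real.pi ^ 2 / 2 * (1 - Real.cos θ)) ^ m * S) := by
          gcongr
          exact sq_le_mul_one_sub_cos (abs_le.2 ⟨by linarith [hθ.1, Real.pi_pos], hθ.2⟩)
      _ = (Real.pi ^ 2 / 2) ^ m * ((N : ℝ) ^ (2 * m) * ((1 - Real.cos θ) ^ m * S)) := by
          rw [mul_pow]
          ring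
      _ ≤ (Real.pi ^ 2 / 2) ^ m *
            ((N : ℝ) ^ (2 * m) * (C * (N : ℝ) ^ (μ - 2 * m + 2 * k + 2))) := by
          gcongr (Real.pi ^ 2 / 2) ^ m * ((N : ℝ) ^ (2 * m) * ?_)
      _ = (Real.pi ^ 2 / 2) ^ m * C * (N : ℝ) ^ (μ + 2 * k + 2) := by
          rw [show μ + 2 * k + 2 = (2 * m : ℕ) + (μ - 2 * m + 2 * k + 2) by push_cast; ring,
            zpow_add₀ hN₀.ne' (2 * m : ℕ), zpow_natCast]
          ring
  refine (mul_one_add_pow_le (abs_nonneg _) (mul_nonneg hN₀.le hθ.1) hq near far).trans_eq ?_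
  ring

end Localization

/-! ### Legendre expansion of the wavelet -/

section Window

variable {κ : ℝ → ℝ} {a b : ℝ}

theorem contDiff_indicator_Ici {r : WithTop ℕ∞} (ha : 0 < a) (hκ : ContDiffOn ℝ r κ (Ici 0))
    (hzero : ∀ t ∈ Ico 0 a, κ t = 0) : ContDiff ℝ r ((Ici 0).indicator κ) := by
  refine contDiff_iff_contDiffAt.2 fun t ↦ ?_
  rcases lt_or_ge 0 t with ht | ht
  · refine ((hκ t ht.le).contDiffAt (Ici_mem_nhds ht)).congr_of_eventuallyEq ?_
    filter_upwards [Ici_mem_nhds ht] with s hs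
    exact indicator_of_mem hs κ
  · refine (contDiffAt_const (c := (0 : ℝ))).congr_of_eventuallyEq ?_
    filter_upwards [Iio_mem_nhds (ht.trans_lt ha)] with s hs
    exact indicator_apply_eq_zero.2 fun hs0 ↦ hzero s ⟨hs0, hs⟩

theorem isSymbol_window {r : ℕ} (ha : 0 < a) (hκ : ContDiffOn ℝ r κ (Ici 0))
    (hsupp : ∀ t ≥ 0, t ∉ Icc a b → κ t = 0) : IsSymbol r 0 fun (N n : ℕ) ↦ κ (n / N) := by
  have hsmooth : ContDiff ℝ r ((Ici 0).indicator κ) :=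
    contDiff_indicator_Ici ha hκ fun t ht ↦ hsupp t ht.1 fun hmem ↦ ht.2.not_ge hmem.1
  have hcompact : HasCompactSupport ((Ici 0).indicator κ) :=
    .intro isCompact_Icc fun t ht ↦ indicator_apply_eq_zero.2 fun ht0 ↦ hsupp t ht0 ht
  have hext (N n : ℕ) : κ (n / N) = (Ici 0).indicator κ ((n : ℝ) / N) :=
    (indicator_of_mem (mem_Ici.2 (by positivity)) κ).symm
  simpa only [hext] using isSymbol_sample hsmooth hcompact

theorem mul_le_and_le_mul_of_div_mem_Icc {n N : ℕ} (ha : 0 < a)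
    (h : (n : ℝ) / N ∈ Icc a b) : a * N ≤ n ∧ n ≤ b * N := by
  have hN : (0 : ℝ) < N := by
    refine N.cast_nonneg.lt_of_ne' fun hN ↦ ?_
    rw [hN, div_zero] at h
    exact h.1.not_gt ha
  exact ⟨(le_div_iff₀ hN).1 h.1, (div_le_iff₀ hN).1 h.2⟩

theorem window_div_eq_zero_of_lt_mul {n N : ℕ} (ha : 0 < a)
    (hsupp : ∀ t ≥ 0, t ∉ Icc a b → κ t = 0) (hn : (n : ℝ) < a * N) : κ (n / N) = 0 :=
  hsupp _ (by positivity) fun h ↦ hn.not_ge (mul_le_and_le_mul_of_div_mem_Icc ha h).1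

theorem window_div_eq_zero_of_mul_lt {n N : ℕ} (ha : 0 < a)
    (hsupp : ∀ t ≥ 0, t ∉ Icc a b → κ t = 0) (hn : b * N < (n : ℝ)) : κ (n / N) = 0 :=
  hsupp _ (by positivity) fun h ↦ hn.not_ge (mul_le_and_le_mul_of_div_mem_Icc ha h).2

end Window

section WaveletWeight

variable {ι : Type*}

theorem factorial_sub_div_factorial_add {n j : ℕ} (h : j ≤ n) :
    ((n - j).factorial : ℝ) / (n + j).factorial =
      (∏ i ∈ Finset.range (2 * j), ((n : ℝ) + ((i : ℝ) + 1 - j)))⁻¹ := by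
  have hfactorial : (n + j).factorial =
      (n - j).factorial * ∏ i ∈ Finset.range (2 * j), (n - j + 1 + i) := by
    rw [← Nat.ascFactorial_eq_prod_range, Nat.factorial_mul_ascFactorial]
    congr 1
    omega
  rw [hfactorial, Nat.cast_mul, div_mul_cancel_left₀ (by positivity), Nat.cast_prod]
  refine congrArg _ (Finset.prod_congr rfl fun i _ ↦ ?_)
  push_cast [Nat.cast_sub h]
  ring

theorem isSymbol_sqrt_factorial_div (j r : ℕ) :
    IsSymbol r (-(j : ℤ)) fun (_ : ι) n ↦ √(((n - j).factorial : ℝ) / (n + j).factorial) := by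
  set s := Finset.range (2 * j) with hs
  set shift : ℕ → ℝ := fun i ↦ (i : ℝ) + 1 - j
  have order_eq : -(s.card : ℤ) = 2 * -(j : ℤ) := by simp [hs]
  have prod_isTheta := isTheta_prod_natCast_add (ι := ι) s shift
  have inv_isTheta := prod_isTheta.inv
  simp only [← zpow_neg, order_eq] at inv_isTheta
  have inv_isSymbol := (isSymbol_prod_natCast_add (ι := ι) s shift r).inv prod_isTheta.symm.isBigO
  rw [order_eq] at inv_isSymbol
  have ratio_eventuallyEq : ∀ᶠ x : ι × ℕ in ⊤ ×ˢ atTop,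
      (∏ i ∈ s, ((x.2 : ℝ) + shift i))⁻¹ = ((x.2 - j).factorial : ℝ) / (x.2 + j).factorial := by
    filter_upwards [(eventually_ge_atTop j).prod_inr _] with x hx
    exact (factorial_sub_div_factorial_add hx).symm
  exact (inv_isSymbol.congr' ratio_eventuallyEq).sqrt
    (inv_isTheta.isBigO_symm.congr' .rfl ratio_eventuallyEq) fun _ n ↦ by positivity

/-- The dependence on the degree `n` of the coefficient of order `k` of a directional wavelet, apart
from the factor `(2 * n + 1) * κ (n / N)`. The subtraction `n - |k|` truncates only where
`(d / dx) ^ |k| P_n` vanishes. -/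
noncomputable def waveletWeight (K : ℕ) (k : ℤ) (n : ℕ) : ℝ :=
  √(1 / 2 ^ binomTop K n * ((binomTop K n).choose (((binomTop K n : ℤ) - k) / 2).toNat : ℝ)) *
    √(((n - k.natAbs).factorial : ℝ) / (n + k.natAbs).factorial)

theorem binomTop_eq_of_le {K n : ℕ} (h : K ≤ n) : binomTop K n = K - 1 := by
  grind [binomTop]

theorem isSymbol_waveletWeight (K : ℕ) (k : ℤ) (r : ℕ) :
    IsSymbol r (-(k.natAbs : ℤ)) fun (_ : ι) ↦ waveletWeight K k := by
  refine ((isSymbol_sqrt_factorial_div k.natAbs r).const_mul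
    √(1 / 2 ^ (K - 1) * ((K - 1).choose (((K - 1 : ℕ) - k) / 2).toNat : ℝ))).congr' ?_
  filter_upwards [(eventually_ge_atTop K).prod_inr _] with x hx
  simp only [waveletWeight, binomTop_eq_of_le hx, Pi.smul_apply, smul_eq_mul]

end WaveletWeight

section Expansion

theorem iterate_derivative_legendreP_eq_zero {n k : ℕ} (h : n < k) :
    derivative^[k] (legendreP n) = 0 := by
  rw [legendreP, iterate_derivative_C_mul, ← Function.iterate_add_apply,
    iterate_derivative_eq_zero, mul_zero]
  have hdegree : ((X ^ 2 - 1 : ℝ[X]) ^ n).natDegree ≤ n * 2 :=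
    natDegree_pow_le_of_le n (natDegree_X_pow_sub_C (n := 2) (r := (1 : ℝ))).le
  omega

theorem assocLegendreNat_cos (n j : ℕ) {θ : ℝ} (hθ : θ ∈ Icc 0 Real.pi) :
    assocLegendreNat n j (Real.cos θ) =
      Real.sin θ ^ j * (derivative^[j] (legendreP n)).eval (Real.cos θ) := by
  rw [assocLegendreNat, ← Real.sin_sq, Real.sqrt_sq (Real.sin_nonneg_of_mem_Icc hθ)]

theorem sqrt_mul_assocLegendre_neg {n j : ℕ} (hj : j ≤ n) (x : ℝ) :
    √(((n + j).factorial : ℝ) / (n - j).factorial) * assocLegendre n (-j) x =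
      (-1) ^ j * (√(((n - j).factorial : ℝ) / (n + j).factorial) * assocLegendreNat n j x) := by
  rcases Nat.eq_zero_or_pos j with rfl | hpos
  · simp [assocLegendre]
  have hsqrt : √(((n + j).factorial : ℝ) / (n - j).factorial) *
      ((n - j).factorial / (n + j).factorial) =
      √(((n - j).factorial : ℝ) / (n + j).factorial) := by
    rw [← inv_div ((n - j).factorial : ℝ), Real.sqrt_inv, inv_mul_eq_div, Real.div_sqrt]
  rw [assocLegendre, if_neg (by omega), neg_neg, Int.toNat_natCast, ← sub_eq_add_neg,
    sub_neg_eq_add, ← Nat.cast_sub hj, ← Nat.cast_add, Int.toNat_natCast, Int.toNat_natCast,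
    zpow_neg, zpow_natCast, ← inv_pow, inv_neg_one, ← hsqrt]
  ring

theorem sphericalHarmonic_eq {n : ℕ} {k : ℤ} (hk : k.natAbs ≤ n) (θ φ : ℝ) :
    sphericalHarmonic n k θ φ = (-1) ^ k.toNat * Complex.exp (Complex.I * k * φ) *
      ((√((2 * (n : ℝ) + 1) / (4 * Real.pi)) *
        (√(((n - k.natAbs).factorial : ℝ) / (n + k.natAbs).factorial) *
          assocLegendreNat n k.natAbs (Real.cos θ)) : ℝ) : ℂ) := by
  rw [sphericalHarmonic, Real.sqrt_mul (by positivity)]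
  obtain ⟨j, rfl | rfl⟩ := k.eq_nat_or_neg
  · rw [Int.natAbs_natCast] at hk ⊢
    rw [assocLegendre, if_pos j.cast_nonneg, Int.toNat_natCast, ← Nat.cast_sub hk, ← Nat.cast_add,
      Int.toNat_natCast, Int.toNat_natCast, zpow_natCast]
    push_cast
    ring
  · rw [Int.natAbs_neg, Int.natAbs_natCast] at hk ⊢
    have hsign : (-1 : ℂ) ^ (-j : ℤ) * (-1) ^ j = 1 := by
      rw [zpow_neg, zpow_natCast, inv_mul_cancel₀ (by simp)]
    have h := congrArg Complex.ofReal (sqrt_mul_assocLegendre_neg hk (Real.cos θ))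
    push_cast at h
    rw [sub_neg_eq_add, ← sub_eq_add_neg, ← Nat.cast_sub hk, ← Nat.cast_add, Int.toNat_natCast,
      Int.toNat_natCast, Int.toNat_neg_natCast, pow_zero]
    push_cast
    linear_combination (-1 : ℂ) ^ (-j : ℤ) * √((2 * (n : ℝ) + 1) / (4 * Real.pi)) *
      Complex.exp (Complex.I * -j * φ) * h + √((2 * (n : ℝ) + 1) / (4 * Real.pi)) *
        (√(((n - j).factorial : ℝ) / (n + j).factorial) * assocLegendreNat n j (Real.cos θ)) *
          Complex.exp (Complex.I * -j * φ) * hsign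

/-- The part of the coefficient of order `k` of a directional wavelet that does not depend on the
degree. -/
noncomputable def waveletPhase (K : ℕ) (k : ℤ) (φ : ℝ) : ℂ :=
  ((√(8 * Real.pi ^ 2) * √(4 * Real.pi))⁻¹ : ℝ) * (eta K * nu K k) *
    ((-1) ^ k.toNat * Complex.exp (Complex.I * k * φ))

theorem norm_waveletPhase_le (K : ℕ) (k : ℤ) (φ : ℝ) : ‖waveletPhase K k φ‖ ≤ 1 := by
  have norm_eta : ‖eta K‖ = 1 := by unfold eta; split_ifs <;> simp
  have norm_nu_le : ‖nu K k‖ ≤ 1 := by unfold nu; split_ifs <;> simp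
  have norm_exp : ‖Complex.exp (Complex.I * k * φ)‖ = 1 := by
    rw [mul_assoc, mul_comm]
    exact_mod_cast Complex.norm_exp_ofReal_mul_I (k * φ)
  have one_le_sqrt_mul_sqrt : 1 ≤ √(8 * Real.pi ^ 2) * √(4 * Real.pi) := by
    have hpi := Real.pi_gt_three
    refine one_le_mul_of_one_le_of_one_le ?_ ?_ <;> rw [Real.one_le_sqrt] <;> nlinarith
  rw [waveletPhase, norm_mul, norm_mul, norm_mul, norm_mul, norm_eta, norm_exp,
    norm_pow, norm_neg, norm_one, one_pow, one_mul, mul_one, mul_one, Complex.norm_real,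
    Real.norm_of_nonneg (by positivity)]
  exact mul_le_one₀ (inv_le_one_of_one_le₀ one_le_sqrt_mul_sqrt) (norm_nonneg _) norm_nu_le

theorem mul_directionality_mul_sphericalHarmonic_eq {K n : ℕ} {k : ℤ} (hk : k.natAbs ≤ n)
    (hkK : |k| ≤ (K : ℤ) - 1) (y : ℝ) {θ : ℝ} (hθ : θ ∈ Icc 0 Real.pi) (φ : ℝ) :
    (√((2 * (n : ℝ) + 1) / (8 * Real.pi ^ 2)) : ℂ) * y *
      directionality K n k * sphericalHarmonic n k θ φ =
    waveletPhase K k φ * ((Real.sin θ ^ k.natAbs * ((2 * n + 1) * (y * waveletWeight K k n) *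
      (derivative^[k.natAbs] (legendreP n)).eval (Real.cos θ)) : ℝ) : ℂ) := by
  have hsqrt : √((2 * (n : ℝ) + 1) / (8 * Real.pi ^ 2)) * √((2 * (n : ℝ) + 1) / (4 * Real.pi)) =
      (√(8 * Real.pi ^ 2) * √(4 * Real.pi))⁻¹ * (2 * (n : ℝ) + 1) := by
    rw [Real.sqrt_div (by positivity), Real.sqrt_div (by positivity), div_mul_div_comm,
      Real.mul_self_sqrt (by positivity), div_eq_inv_mul]
  rw [sphericalHarmonic_eq hk, directionality, if_pos hkK, waveletPhase, waveletWeight,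
    assocLegendreNat_cos _ _ hθ]
  have h := congrArg Complex.ofReal hsqrt
  push_cast at h ⊢
  linear_combination (y * (eta K * nu K k) * √(1 / 2 ^ binomTop K n *
    ((binomTop K n).choose (((binomTop K n : ℤ) - k) / 2).toNat : ℝ)) *
    ((-1) ^ k.toNat * Complex.exp (Complex.I * k * φ)) *
    √(((n - k.natAbs).factorial : ℝ) / (n + k.natAbs).factorial) *
    (Complex.sin θ ^ k.natAbs *
      Complex.ofReal ((derivative^[k.natAbs] (legendreP n)).eval (Real.cos θ)))) * h

theorem wavelet_eq_sum {κ : ℝ → ℝ} {K N M : ℕ} (hκ : ∀ n ≥ M, κ ((n : ℝ) / N) = 0)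
    {θ : ℝ} (hθ : θ ∈ Icc 0 Real.pi) (φ : ℝ) :
    wavelet κ K N θ φ = ∑ k ∈ Finset.Icc (-((K : ℤ) - 1)) ((K : ℤ) - 1), waveletPhase K k φ *
      ((Real.sin θ ^ k.natAbs *
        (legendreSum k.natAbs M fun n ↦ κ (n / N) * waveletWeight K k n).eval (Real.cos θ) :
          ℝ) : ℂ) := by
  have wavelet_eq_partialSum : wavelet κ K N θ φ = ∑ n ∈ Finset.range M,
      ∑ k ∈ Finset.Icc (-(n : ℤ)) n, (√((2 * (n : ℝ) + 1) / (8 * Real.pi ^ 2)) : ℂ) *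
        (κ ((n : ℝ) / N) : ℂ) * directionality K n k * sphericalHarmonic n k θ φ :=
    tsum_eq_sum fun n hn ↦ by simp [hκ n (by simpa using hn)]
  simp only [wavelet_eq_partialSum, eval_legendreSum, Finset.mul_sum, Complex.ofReal_sum]
  rw [Finset.sum_comm (s := Finset.Icc _ _)]
  refine Finset.sum_congr rfl fun n _ ↦ Finset.sum_congr_of_eq_on_inter ?_ ?_ ?_
  · intro k _ hk
    rw [Finset.mem_Icc, ← abs_le] at hk
    simp [directionality, hk]
  · intro k _ hk
    rw [Finset.mem_Icc] at hk
    simp [iterate_derivative_legendreP_eq_zero (show n < k.natAbs by omega)]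
  · intro k hk hkK
    rw [Finset.mem_Icc] at hk
    rw [Finset.mem_Icc, ← abs_le] at hkK
    exact mul_directionality_mul_sphericalHarmonic_eq (by omega) hkK _ hθ φ

end Expansion

section WaveletBound

variable {κ : ℝ → ℝ} {a b : ℝ} {q m : ℕ}

theorem exists_sin_pow_mul_abs_eval_legendreSum_le (K : ℕ) (k : ℤ) {M : ℕ} (hq : q ≤ 2 * m)
    (ha : 0 < a) (hκ : ContDiffOn ℝ (2 * m : ℕ) κ (Ici 0))
    (hsupp : ∀ t ≥ 0, t ∉ Icc a M → κ t = 0) :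
    ∃ C > 0, ∀ N : ℕ, 1 ≤ N → ∀ θ ∈ Icc 0 Real.pi,
      Real.sin θ ^ k.natAbs * |(legendreSum k.natAbs (M * N + 1)
        fun n ↦ κ (n / N) * waveletWeight K k n).eval (Real.cos θ)| ≤
      C * (N : ℝ) ^ 2 / (1 + N * θ) ^ q * (N * Real.sin θ) ^ k.natAbs := by
  have hsymbol : IsSymbol (2 * m) (0 + -(k.natAbs : ℤ))
      fun (N n : ℕ) ↦ κ (n / N) * waveletWeight K k n :=
    (isSymbol_window ha hκ hsupp).mul (isSymbol_waveletWeight K k _)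
  obtain ⟨C, hC, hbound⟩ := exists_abs_eval_cos_legendreSum_mul_le (b := M) k.natAbs hq ha hsymbol
    (fun N n hn ↦ by rw [window_div_eq_zero_of_lt_mul ha hsupp hn, zero_mul])
    (fun N n hn ↦ by rw [window_div_eq_zero_of_mul_lt ha hsupp (mod_cast hn), zero_mul])
  refine ⟨C, hC, fun N hN θ hθ ↦ ?_⟩
  have hsin : 0 ≤ Real.sin θ := Real.sin_nonneg_of_mem_Icc hθ
  have hθ₀ : 0 ≤ θ := hθ.1
  have h := hbound N hN θ hθ
  rw [show 0 + -(k.natAbs : ℤ) + 2 * k.natAbs + 2 = (k.natAbs + 2 : ℕ) by push_cast; ring,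
    zpow_natCast, ← le_div_iff₀ (by positivity)] at h
  calc _ ≤ Real.sin θ ^ k.natAbs * (C * (N : ℝ) ^ (k.natAbs + 2) / (1 + N * θ) ^ q) := by gcongr
    _ = C * (N : ℝ) ^ 2 / (1 + N * θ) ^ q * (N * Real.sin θ) ^ k.natAbs := by ring

theorem exists_norm_wavelet_le {K : ℕ} (hK : 1 ≤ K) (hq : q ≤ 2 * m) (ha : 0 < a)
    (hκ : ContDiffOn ℝ (2 * m : ℕ) κ (Ici 0)) (hsupp : ∀ t ≥ 0, t ∉ Icc a b → κ t = 0) :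
    ∃ C > 0, ∀ N : ℕ, 1 ≤ N → ∀ θ ∈ Icc 0 Real.pi, ∀ φ : ℝ, ‖wavelet κ K N θ φ‖ ≤
      C * (N : ℝ) ^ 2 / (1 + N * θ) ^ q * ∑ k ∈ Finset.range K, (N * Real.sin θ) ^ k := by
  obtain ⟨M, hM⟩ := exists_nat_ge b
  replace hsupp (t : ℝ) (ht : t ≥ 0) (hmem : t ∉ Icc a M) : κ t = 0 :=
    hsupp t ht fun h ↦ hmem (Icc_subset_Icc_right hM h)
  choose C hC hbound using fun k : ℤ ↦
    exists_sin_pow_mul_abs_eval_legendreSum_le K k hq ha hκ hsupp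
  refine ⟨∑ k ∈ Finset.Icc (-((K : ℤ) - 1)) ((K : ℤ) - 1), C k,
    Finset.sum_pos (fun k _ ↦ hC k) ⟨0, Finset.mem_Icc.2 (by omega)⟩, fun N hN θ hθ φ ↦ ?_⟩
  have hsin : 0 ≤ Real.sin θ := Real.sin_nonneg_of_mem_Icc hθ
  have hθ₀ : 0 ≤ θ := hθ.1
  have hvanish (n : ℕ) (hn : n ≥ M * N + 1) : κ ((n : ℝ) / N) = 0 :=
    window_div_eq_zero_of_mul_lt ha hsupp (mod_cast hn)
  rw [wavelet_eq_sum hvanish hθ, Finset.sum_mul, Finset.sum_div, Finset.sum_mul]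
  refine (norm_sum_le _ _).trans (Finset.sum_le_sum fun k hk ↦ ?_)
  rw [Finset.mem_Icc] at hk
  have hsingle : (N * Real.sin θ) ^ k.natAbs ≤ ∑ k ∈ Finset.range K, (N * Real.sin θ) ^ k :=
    Finset.single_le_sum (f := fun j ↦ (N * Real.sin θ) ^ j) (fun j _ ↦ by positivity)
      (Finset.mem_range.2 (by omega))
  rw [norm_mul, Complex.norm_real, Real.norm_eq_abs, abs_mul, abs_of_nonneg (pow_nonneg hsin _)]
  have hCk := hC k
  calc _ ≤ 1 * (C k * (N : ℝ) ^ 2 / (1 + N * θ) ^ q * (N * Real.sin θ) ^ k.natAbs) :=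
        mul_le_mul (norm_waveletPhase_le K k φ) (hbound k N hN θ hθ) (by positivity) zero_le_one
    _ ≤ C k * (N : ℝ) ^ 2 / (1 + N * θ) ^ q * ∑ k ∈ Finset.range K, (N * Real.sin θ) ^ k := by
        rw [one_mul]
        gcongr

theorem sum_range_pow_le {s u : ℝ} (hs : 0 ≤ s) (hsu : s ≤ u) (hu : 1 ≤ u) (K : ℕ) :
    ∑ k ∈ Finset.range K, s ^ k ≤ K * u ^ (K - 1) := by
  refine (Finset.sum_le_card_nsmul _ _ (u ^ (K - 1)) fun k hk ↦ ?_).trans_eq (by simp)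
  exact (pow_le_pow_left₀ hs hsu k).trans
    (pow_le_pow_right₀ hu (Nat.le_sub_one_of_lt (Finset.mem_range.1 hk)))

end WaveletBound

end DirectionalWavelet

open DirectionalWavelet in
theorem mainTheorem3_general {κ : ℝ → ℝ} {a b : ℝ} {K q m : ℕ} (hK : 1 ≤ K) (hq : q ≤ 2 * m)
    (ha : 0 < a) (hκ : ContDiffOn ℝ (2 * m : ℕ) κ (Set.Ici 0))
    (hsupp : ∀ t ≥ 0, t ∉ Set.Icc a b → κ t = 0) :
    ∃ c > 0, ∀ N : ℕ, 1 ≤ N → ∀ θ ∈ Set.Icc 0 Real.pi, ∀ φ : ℝ,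
      ‖wavelet κ K N θ φ‖ ≤
          c * (N : ℝ) ^ 2 / (1 + N * θ) ^ q * ∑ k ∈ Finset.range K, (N * Real.sin θ) ^ k ∧
      ‖wavelet κ K N θ φ‖ ≤ c * (N : ℝ) ^ 2 / (1 + N * θ) ^ ((q : ℤ) + 1 - K) := by
  obtain ⟨C, hC, hbound⟩ := exists_norm_wavelet_le hK hq ha hκ hsupp
  have hK₁ : (1 : ℝ) ≤ K := Nat.one_le_cast.2 hK
  refine ⟨C * K, by positivity, fun N hN θ hθ φ ↦ ?_⟩
  have hsin : 0 ≤ Real.sin θ := Real.sin_nonneg_of_mem_Icc hθ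
  have hθ₀ : 0 ≤ θ := hθ.1
  have hsin_le : N * Real.sin θ ≤ 1 + N * θ := by
    linarith [mul_le_mul_of_nonneg_left (Real.sin_le hθ₀) (N.cast_nonneg (α := ℝ))]
  have h := hbound N hN θ hθ φ
  refine ⟨h.trans (by gcongr; exact le_mul_of_one_le_right hC.le hK₁), ?_⟩
  calc ‖wavelet κ K N θ φ‖
      ≤ C * (N : ℝ) ^ 2 / (1 + N * θ) ^ q * (K * (1 + N * θ) ^ (K - 1)) := by
        grw [h, sum_range_pow_le (by positivity) hsin_le (le_add_of_nonneg_right (by positivity))]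
    _ = C * K * (N : ℝ) ^ 2 / (1 + N * θ) ^ ((q : ℤ) + 1 - K) := by
        rw [show (q : ℤ) + 1 - K = q - (K - 1 : ℕ) by omega, zpow_sub₀ (by positivity),
          zpow_natCast, zpow_natCast]
        field_simp

theorem mainTheorem3 (κ : ℝ → ℝ) (K q : ℕ) (hK : 1 ≤ K) (hq : 1 ≤ q)
    (hκ : DirectionalWavelet.IsWindow (3 * q - 1) κ) :
    ∃ c : ℝ, 0 < c ∧
      ∀ N : ℕ, 1 ≤ N → ∀ θ ∈ Set.Icc (0 : ℝ) Real.pi, ∀ φ ∈ Set.Ico (0 : ℝ) (2 * Real.pi),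
        ‖DirectionalWavelet.wavelet κ K N θ φ‖ ≤
            c * (N : ℝ) ^ 2 / (1 + (N : ℝ) * θ) ^ q *
              ∑ k ∈ Finset.range K, ((N : ℝ) * Real.sin θ) ^ k ∧
        ‖DirectionalWavelet.wavelet κ K N θ φ‖ ≤
            c * (N : ℝ) ^ 2 / (1 + (N : ℝ) * θ) ^ ((q : ℤ) + 1 - (K : ℤ)) := by
  have hsmooth : ContDiffOn ℝ (2 * ((q + 1) / 2) : ℕ) κ (Set.Ici 0) :=
    hκ.contDiffOn.of_le (mod_cast (by omega))
  obtain ⟨c, hc, hbound⟩ := mainTheorem3_general hK (q := q)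
    (m := (q + 1) / 2) (by omega) one_half_pos hsmooth
    fun t ht hmem ↦ by_contra fun hne ↦ hmem (hκ.support_subset (subset_closure ⟨hne, ht⟩))
  exact ⟨c, hc, fun N hN θ hθ φ _ ↦ hbound N hN θ hθ φ⟩
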